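/- Let $1 < p < +\infty$ and let $L^p([0,1])$ be the complex $L^p$-space of $[0,1]$ with Lebesgue measure. For $\alpha \in [0,1]$ let $T_\alpha$ be the Bishop operator on $L^p([0,1])$, the bounded operator defined by \[ T_\alpha f(x) = x\, f(\{x+\alpha\}) \quad \text{for a.e. } x \in [0,1], \] where $\{\cdot\}$ denotes the fractional part. A bounded operator $T$ on a complex Banach space $X$ is called cyclic if there is $x \in X$ such that the linear span of $\{T^n x : n \ge 0\}$ is dense in $X$. Then the set \[ \{\alpha \in [0,1] : T_\alpha \text{ is cyclic}\} \] is co-meager in $[0,1]$, that is, it contains a dense $G_\delta$ subset of $[0,1]$. -/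

import Mathlib

open MeasureTheory Set
open scoped ENNReal

namespace Bishop

noncomputable section

/-- A vector `x` is cyclic for the bounded operator `T` when the linear span of its orbit
`{T ^ n x ; n ≥ 0}` is dense. -/
def IsCyclicVector {X : Type*} [NormedAddCommGroup X] [NormedSpace ℂ X]
    (T : X →L[ℂ] X) (x : X) : Prop :=
  Dense (Submodule.span ℂ (range fun n : ℕ => (T ^ n) x) : Set X)

/-- A bounded operator is cyclic when it admits a cyclic vector. -/
def IsCyclic {X : Type*} [NormedAddCommGroup X] [NormedSpace ℂ X] (T : X →L[ℂ] X) : Prop :=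
  ∃ x : X, IsCyclicVector T x

/-- Lebesgue measure on `[0, 1]`. -/
def leb : Measure ℝ := volume.restrict (Icc (0 : ℝ) 1)

/-- The complex Banach space `L ^ p([0, 1])`. -/
abbrev LpUnit (p : ℝ≥0∞) : Type := Lp ℂ p leb

/-- The translation `x ↦ {x + α}`. -/
def shift (α x : ℝ) : ℝ := Int.fract (x + α)

theorem measurable_shift (α : ℝ) : Measurable (shift α) :=
  measurable_fract.comp (measurable_id.add_const α)

/-- The translation modulo one preserves Lebesgue measure on `[0, 1]`. -/
theorem measurePreserving_shift (α : ℝ) : MeasurePreserving (shift α) leb leb := by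
  refine ⟨measurable_shift α, ?_⟩
  ext s hs
  rw [Measure.map_apply (measurable_shift α) hs]
  have hA : MeasurableSet (Int.fract ⁻¹' s : Set ℝ) := measurable_fract hs
  have e1 : leb = volume.restrict (Ioc (0 : ℝ) 1) :=
    (Measure.restrict_congr_set Ioc_ae_eq_Icc).symm
  have e2 : leb = volume.restrict (Ico (0 : ℝ) 1) :=
    (Measure.restrict_congr_set Ico_ae_eq_Icc).symm
  have h1 : leb (shift α ⁻¹' s) = volume ((Int.fract ⁻¹' s : Set ℝ) ∩ Ioc α (α + 1)) := by
    rw [e1, Measure.restrict_apply (measurable_shift α hs),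
      ← measure_preimage_add_right volume α ((Int.fract ⁻¹' s : Set ℝ) ∩ Ioc α (α + 1))]
    congr 1
    ext x
    simp only [shift, mem_inter_iff, mem_preimage, mem_Ioc]
    constructor <;> rintro ⟨h, h', h''⟩ <;> exact ⟨h, by linarith, by linarith⟩
  have h2 : leb s = volume ((Int.fract ⁻¹' s : Set ℝ) ∩ Ioc 0 (0 + 1)) := by
    rw [zero_add, ← Measure.restrict_apply hA, ← e1, e2, Measure.restrict_apply hs,
      Measure.restrict_apply hA]
    congr 1
    ext x
    simp only [mem_inter_iff, mem_preimage]
    refine and_congr_left fun hx => ?_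
    rw [Int.fract_eq_self.2 hx]
  rw [h1, h2]
  refine (isAddFundamentalDomain_Ioc (T := (1 : ℝ)) one_pos α).measure_set_eq
    (isAddFundamentalDomain_Ioc (T := (1 : ℝ)) one_pos 0) hA ?_
  rintro ⟨g, hg⟩
  obtain ⟨n, rfl⟩ := AddSubgroup.mem_zmultiples_iff.1 hg
  ext x
  simp [AddSubgroup.vadd_def]

theorem norm_weight_le {f g : ℝ → ℂ} (h : ∀ x, f x = (x : ℂ) * g x) :
    ∀ᵐ x ∂leb, ‖f x‖ ≤ ‖g x‖ := by
  filter_upwards [ae_restrict_mem (measurableSet_Icc (a := (0 : ℝ)) (b := 1))] with x hx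
  rw [h, norm_mul, Complex.norm_real, Real.norm_of_nonneg hx.1]
  exact mul_le_of_le_one_left (norm_nonneg _) hx.2

theorem memLp_bishop {p : ℝ≥0∞} (α : ℝ) {f : ℝ → ℂ} (hf : MemLp f p leb) :
    MemLp (fun x : ℝ => (x : ℂ) * f (shift α x)) p leb := by
  have h := hf.comp_measurePreserving (measurePreserving_shift α)
  exact h.mono (Complex.measurable_ofReal.aestronglyMeasurable.mul h.1)
    (norm_weight_le fun _ => rfl)

/-- The Bishop operator `T_α f(x) = x f({x + α})`, as a bounded operator on `L ^ p([0, 1])`. -/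
def bishop (p : ℝ≥0∞) [Fact (1 ≤ p)] (α : ℝ) : LpUnit p →L[ℂ] LpUnit p :=
  LinearMap.mkContinuous
    { toFun := fun f => (memLp_bishop α (Lp.memLp f)).toLp
        (fun x : ℝ => (x : ℂ) * f (shift α x))
      map_add' := by
        intro f g
        rw [← MemLp.toLp_add]
        refine MemLp.toLp_congr _ _ ?_
        filter_upwards [(measurePreserving_shift α).quasiMeasurePreserving.ae
          (Lp.coeFn_add f g)] with x hx
        simp only [Pi.add_apply] at hx ⊢
        rw [hx, mul_add]
      map_smul' := by
        intro c f
        rw [RingHom.id_apply, ← MemLp.toLp_const_smul]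
        refine MemLp.toLp_congr _ _ ?_
        filter_upwards [(measurePreserving_shift α).quasiMeasurePreserving.ae
          (Lp.coeFn_smul c f)] with x hx
        simp only [Pi.smul_apply, smul_eq_mul] at hx ⊢
        rw [hx]
        ring }
    1 (by
      intro f
      have h := (Lp.memLp f).comp_measurePreserving (measurePreserving_shift α)
      rw [one_mul, LinearMap.coe_mk, AddHom.coe_mk, Lp.norm_toLp, Lp.norm_def]
      refine ENNReal.toReal_mono (Lp.eLpNorm_ne_top f) ?_
      calc eLpNorm (fun x : ℝ => (x : ℂ) * f (shift α x)) p leb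
          ≤ eLpNorm (f ∘ shift α) p leb := eLpNorm_mono_ae (norm_weight_le fun _ => rfl)
        _ = eLpNorm f p leb :=
          eLpNorm_comp_measurePreserving (Lp.aestronglyMeasurable f) (measurePreserving_shift α))

/-- The defining formula of the Bishop operator, almost everywhere on `[0, 1]`. -/
theorem bishop_apply_ae (p : ℝ≥0∞) [Fact (1 ≤ p)] (α : ℝ) (f : LpUnit p) :
    ∀ᵐ x : ℝ ∂volume.restrict (Icc (0 : ℝ) 1),
      bishop p α f x = (x : ℂ) * f (Int.fract (x + α)) :=
  MemLp.coeFn_toLp (memLp_bishop α (Lp.memLp f))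

end

end Bishop

/-!
A vector `f` is cyclic for `T_α` if and only if, for every nonempty `V` in a countable base, some
polynomial `P` has `P(T_α) f ∈ V`. Since `α ↦ T_α ^ n f` is continuous
(`continuous_bishop_pow_apply`), the set of `α` admitting such a `P` for some `f` in a given open
set `U` is open; the Baire category theorem, applied in the space of parameters and then in
`L ^ p([0, 1])`, shows that `T_α` is cyclic for generic `α` as soon as cyclic vectors are dense for
a dense set of parameters (`exists_isGδ_dense_isCyclic`). The rational parameters serve for this.

Let `α = r / q` in lowest terms. Then `T ^ q` is the multiplication by
`w(x) = {x} {x + α} ⋯ {x + (q - 1) α}`, which is strictly increasing on every cell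
`[k / q, (k + 1) / q)`. If `e` is the indicator function of `[0, 1 / q)`, then `T ^ j e` is
supported on an arc `I_j` contained in a single cell, where it vanishes almost nowhere, and
`I_0, …, I_{q - 1}` cover `[0, 1)`. For a polynomial `R ≠ 0` the function `R(w)` is almost nowhere
zero too, and polynomials in the injective function `w` times a fixed function that is almost
nowhere zero are dense in `L ^ p(I_j)` (`exists_polynomial_eLpNorm_sub_le`). Hence the vectors
`R(T ^ q) P(T) e` are dense for every `R ≠ 0` (`denseRange_aeval_baseVector`). As every polynomial
`S ≠ 0` divides some `R(X ^ q)` with `R ≠ 0`, all vectors `S(T) e` with `S ≠ 0` are cyclic, and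
these are dense (`dense_isCyclicVector`).
-/

namespace Bishop

open Polynomial Topology Filter

/-! ### Cyclic vectors and polynomials in an operator -/

section Cyclic

variable {X : Type*} [NormedAddCommGroup X] [NormedSpace ℂ X]

theorem aeval_apply_mem_span_orbit (T : X →L[ℂ] X) (x : X) (P : ℂ[X]) :
    aeval T P x ∈ Submodule.span ℂ (range fun n : ℕ => (T ^ n) x) := by
  rw [aeval_eq_sum_range, _root_.sum_apply]
  exact Submodule.sum_mem _ fun n _ =>
    Submodule.smul_mem _ _ (Submodule.subset_span ⟨n, rfl⟩)

theorem isCyclicVector_of_denseRange_aeval {T : X →L[ℂ] X} {x : X}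
    (h : DenseRange fun P : ℂ[X] => aeval T P x) : IsCyclicVector T x :=
  h.mono (range_subset_iff.2 fun P => aeval_apply_mem_span_orbit T x P)

theorem IsCyclicVector.denseRange_aeval {T : X →L[ℂ] X} {x : X} (h : IsCyclicVector T x) :
    DenseRange fun P : ℂ[X] => aeval T P x := by
  let L : ℂ[X] →ₗ[ℂ] X :=
    (ContinuousLinearMap.apply ℂ X x).toLinearMap ∘ₗ (aeval T).toLinearMap
  refine Dense.mono (s₂ := (LinearMap.range L : Set X)) (SetLike.coe_subset_coe.2 ?_) h
  refine Submodule.span_le.2 ?_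
  rintro _ ⟨n, rfl⟩
  exact ⟨Polynomial.X ^ n, by simp [L]⟩

/-- Every nonzero polynomial divides a nonzero polynomial in `X ^ q`: in the finite-dimensional
algebra `ℂ[X] / (P)` the class of `X ^ q` is algebraic. -/
theorem exists_dvd_comp_X_pow {P : ℂ[X]} (hP : P ≠ 0) (q : ℕ) :
    ∃ R : ℂ[X], R ≠ 0 ∧ P ∣ R.comp (Polynomial.X ^ q) := by
  have : Module.Finite ℂ (AdjoinRoot P) := (AdjoinRoot.powerBasis hP).finite
  obtain ⟨R, hR, h0⟩ := Algebra.IsIntegral.isIntegral (R := ℂ) (AdjoinRoot.root P ^ q)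
  refine ⟨R, hR.ne_zero, ?_⟩
  rw [← AdjoinRoot.mk_eq_zero, ← AdjoinRoot.aeval_eq, aeval_comp]
  simpa [aeval_def] using h0

/-- If polynomial multiples of each `R(T ^ q)`, `R ≠ 0`, applied to a fixed vector `e` are dense,
then the vectors `P(T) e` with `P ≠ 0` are cyclic, so the cyclic vectors are dense. -/
theorem dense_isCyclicVector {T : X →L[ℂ] X} {e : X} {q : ℕ}
    (h : ∀ R : ℂ[X], R ≠ 0 →
      DenseRange fun P : ℂ[X] => aeval T (R.comp (Polynomial.X ^ q) * P) e) :
    Dense {x : X | IsCyclicVector T x} := by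
  have hcyc : ∀ P : ℂ[X], P ≠ 0 → IsCyclicVector T (aeval T P e) := by
    intro P hP
    obtain ⟨R, hR, S, hS⟩ := exists_dvd_comp_X_pow hP q
    refine isCyclicVector_of_denseRange_aeval ((h R hR).mono ?_)
    rintro _ ⟨Q, rfl⟩
    refine ⟨S * Q, ?_⟩
    have hc : R.comp (Polynomial.X ^ q) * Q = S * Q * P := by rw [hS]; ring
    simp only [hc, map_mul, mul_apply_eq_comp]
  have h1 : DenseRange fun P : ℂ[X] => aeval T P e := by
    simpa using h 1 one_ne_zero
  refine dense_iff_closure_eq.2 (eq_univ_of_univ_subset ?_)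
  rw [← h1.closure_eq]
  refine closure_minimal ?_ isClosed_closure
  rintro _ ⟨P, rfl⟩
  by_cases hP : P = 0
  · -- The vector `0` is the limit of the cyclic vectors `c • e` as `c → 0`.
    subst hP
    have hlim : Tendsto (fun c : ℂ => c • e) (𝓝[≠] 0) (𝓝 ((0 : ℂ) • e)) :=
      ((continuous_id.smul continuous_const).tendsto (0 : ℂ)).mono_left nhdsWithin_le_nhds
    have h0 : (fun P : ℂ[X] => aeval T P e) 0 = (0 : ℂ) • e := by simp
    rw [h0]
    refine mem_closure_of_tendsto hlim ?_
    filter_upwards [self_mem_nhdsWithin] with c hc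
    have := hcyc (C c) (by simpa using hc)
    simpa [Algebra.algebraMap_eq_smul_one] using this
  · exact subset_closure (hcyc P hP)

end Cyclic

/-! ### Generic cyclicity in a family of operators -/

/-- A Kuratowski–Ulam argument: if the operators `T a` depend continuously on `a` in the strong
sense (with all their powers) and the cyclic vectors of `T a` are dense for a dense set of
parameters `a`, then `T a` is cyclic for generic `a`. -/
theorem exists_isGδ_dense_isCyclic {A X : Type*} [TopologicalSpace A] [BaireSpace A]
    [NormedAddCommGroup X] [NormedSpace ℂ X] [CompleteSpace X] [SecondCountableTopology X]
    (T : A → X →L[ℂ] X) (hT : ∀ (n : ℕ) (x : X), Continuous fun a => (T a ^ n) x)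
    (hD : Dense {a | Dense {x | IsCyclicVector (T a) x}}) :
    ∃ G : Set A, IsGδ G ∧ Dense G ∧ G ⊆ {a | IsCyclic (T a)} := by
  let B := TopologicalSpace.countableBasis X
  have hB : TopologicalSpace.IsTopologicalBasis B := TopologicalSpace.isBasis_countableBasis X
  have hBc : B.Countable := TopologicalSpace.countable_countableBasis X
  have : Countable B := hBc.to_subtype
  have hcont : ∀ (P : ℂ[X]) (x : X), Continuous fun a => aeval (T a) P x := by
    intro P x
    simp only [aeval_eq_sum_range, _root_.sum_apply, _root_.smul_apply]
    exact continuous_finsetSum _ fun n _ => (hT n x).const_smul _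
  -- `W a V` is the set of vectors whose orbit under the algebra generated by `T a` meets `V`.
  let W : A → Set X → Set X := fun a V => ⋃ P : ℂ[X], {x | aeval (T a) P x ∈ V}
  let O : B × B → Set A := fun k => ⋃ x ∈ k.1.1, ⋃ P : ℂ[X], {a | aeval (T a) P x ∈ k.2.1}
  have hO : ∀ k, IsOpen (O k) := fun k =>
    isOpen_biUnion fun x _ => isOpen_iUnion fun P =>
      (hB.isOpen k.2.2).preimage (hcont P x)
  have hOd : ∀ k, Dense (O k) := by
    intro k
    refine hD.mono ?_
    intro a ha
    obtain ⟨x, hxV, hx⟩ := ha.inter_open_nonempty _ (hB.isOpen k.1.2)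
      (TopologicalSpace.nonempty_of_mem_countableBasis k.1.2)
    obtain ⟨P, hP⟩ := hx.denseRange_aeval.exists_mem_open (hB.isOpen k.2.2)
      (TopologicalSpace.nonempty_of_mem_countableBasis k.2.2)
    exact mem_biUnion hxV (mem_iUnion.2 ⟨P, hP⟩)
  refine ⟨⋂ k, O k, IsGδ.iInter_of_isOpen hO, dense_iInter_of_isOpen hO hOd, ?_⟩
  intro a ha
  have hW : ∀ V : B, IsOpen (W a V.1) := fun V =>
    isOpen_iUnion fun P => (hB.isOpen V.2).preimage (aeval (T a) P).continuous
  have hWd : ∀ V : B, Dense (W a V.1) := by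
    intro V
    refine hB.dense_iff.2 ?_
    intro U hU _
    have := mem_iInter.1 ha (⟨U, hU⟩, V)
    simp only [O, mem_iUnion, exists_prop] at this
    obtain ⟨x, hxU, P, hP⟩ := this
    exact ⟨x, hxU, mem_iUnion.2 ⟨P, hP⟩⟩
  obtain ⟨x, hx⟩ := (dense_iInter_of_isOpen hW hWd).nonempty
  refine ⟨x, isCyclicVector_of_denseRange_aeval (hB.dense_iff.2 ?_)⟩
  intro V hV _
  obtain ⟨P, hP⟩ := mem_iUnion.1 (mem_iInter.1 hx ⟨V, hV⟩)
  exact ⟨_, hP, P, rfl⟩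

/-! ### Polynomials in a separating function -/

theorem exists_polynomial_norm_sub_le {φ : ℝ → ℂ} (hφ : Continuous φ) {δ : ℝ} (hδ : 0 < δ) :
    ∃ Q : ℂ[X], ∀ t ∈ Icc (0 : ℝ) 1, ‖φ t - Q.eval (t : ℂ)‖ ≤ δ := by
  obtain ⟨Q₁, h₁⟩ := exists_polynomial_near_of_continuousOn 0 1 (fun t => (φ t).re)
    (Complex.continuous_re.comp hφ).continuousOn (δ / 2) (half_pos hδ)
  obtain ⟨Q₂, h₂⟩ := exists_polynomial_near_of_continuousOn 0 1 (fun t => (φ t).im)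
    (Complex.continuous_im.comp hφ).continuousOn (δ / 2) (half_pos hδ)
  refine ⟨Q₁.map (algebraMap ℝ ℂ) + C Complex.I * Q₂.map (algebraMap ℝ ℂ), fun t ht => ?_⟩
  have e : ∀ Q : ℝ[X], (Q.map (algebraMap ℝ ℂ)).eval (t : ℂ) = (Q.eval t : ℝ) := fun Q =>
    by
    rw [eval_map]
    exact eval₂_at_apply (algebraMap ℝ ℂ) t
  refine (Complex.norm_le_abs_re_add_abs_im _).trans ?_
  have h₁' := h₁ t ht
  have h₂' := h₂ t ht
  rw [abs_sub_comm] at h₁' h₂'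
  simp only [eval_add, eval_mul, eval_C, e]
  simp
  linarith

/-- Weighting `μ` by `|V| ^ p` and pushing forward along `w` turns the `L ^ p` norm of
`φ ∘ w * V` into that of `φ`. -/
theorem eLpNorm_map_withDensity {α : Type*} [MeasurableSpace α] {μ : Measure α} {p : ℝ≥0∞}
    (hp₀ : p ≠ 0) (hp : p ≠ ∞) {w : α → ℝ} (hw : Measurable w) {V : α → ℂ} (hV : Measurable V)
    {φ : ℝ → ℂ} (hφ : Measurable φ) :
    eLpNorm φ p ((μ.withDensity fun x => ‖V x‖ₑ ^ p.toReal).map w) =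
      eLpNorm (fun x => φ (w x) * V x) p μ := by
  rw [eLpNorm_eq_lintegral_rpow_enorm_toReal hp₀ hp, eLpNorm_eq_lintegral_rpow_enorm_toReal hp₀ hp,
    lintegral_map (by fun_prop) hw,
    lintegral_withDensity_eq_lintegral_mul _ (by fun_prop) (by fun_prop)]
  congr 2
  ext x
  rw [Pi.mul_apply, enorm_mul, ENNReal.mul_rpow_of_nonneg _ _ ENNReal.toReal_nonneg, mul_comm]

/-- If `w` separates the points of `I` and `V` vanishes almost nowhere on `I`, then the functions
`Q(w) V`, with `Q` a polynomial, are dense in `L ^ p(I)`. Transporting to the image of `w`, this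
is the density of polynomials in `L ^ p(ν)` for the finite measure `ν = w_*(|V| ^ p μ)`
on `[0, 1]`. -/
theorem exists_polynomial_eLpNorm_sub_le {α : Type*} [MeasurableSpace α] [StandardBorelSpace α]
    {μ : Measure α} {p : ℝ≥0∞} (hp₁ : 1 ≤ p) (hp : p ≠ ∞) {I : Set α} (hI : MeasurableSet I)
    {w : α → ℝ} (hw : Measurable w) (hw01 : ∀ x, w x ∈ Icc (0 : ℝ) 1) (hinj : InjOn w I)
    {V g : α → ℂ} (hVm : Measurable V) (hV : MemLp V p μ) (hgm : Measurable g) (hg : MemLp g p μ)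
    (hVI : ∀ᵐ x ∂μ, x ∈ I → V x ≠ 0) (hgI : ∀ᵐ x ∂μ, x ∉ I → g x = 0)
    (hVI' : ∀ᵐ x ∂μ, x ∉ I → V x = 0) {ε : ℝ≥0∞} (hε : ε ≠ 0) :
    ∃ Q : ℂ[X], eLpNorm (fun x => g x - Q.eval (w x : ℂ) * V x) p μ ≤ ε := by
  have hp₀ : p ≠ 0 := (zero_lt_one.trans_le hp₁).ne'
  set ν := (μ.withDensity fun x => ‖V x‖ₑ ^ p.toReal).map w with hν
  have hfin : IsFiniteMeasure ν := by
    refine ⟨?_⟩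
    rw [hν, Measure.map_apply hw MeasurableSet.univ, preimage_univ,
      withDensity_apply _ MeasurableSet.univ, setLIntegral_univ]
    exact lintegral_rpow_enorm_lt_top_of_eLpNorm_lt_top hp₀ hp hV.2
  have hν01 : ∀ᵐ t ∂ν, t ∈ Icc (0 : ℝ) 1 := by
    rw [hν]
    refine (ae_map_iff hw.aemeasurable measurableSet_Icc).2 ?_
    exact Eventually.of_forall hw01
  -- Transport `g / V` to a function `h` of `w`.
  have hemb : MeasurableEmbedding (fun x : I => w x) := by
    have : StandardBorelSpace I := hI.standardBorel
    exact (hw.comp measurable_subtype_coe).measurableEmbedding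
      (fun x y hxy => Subtype.ext (hinj x.2 y.2 hxy))
  obtain ⟨h, hhm, hh⟩ := hemb.exists_measurable_extend (g := fun x : I => g x / V x)
    ((hgm.div hVm).comp measurable_subtype_coe) (fun _ => ⟨0⟩)
  have hgh : ∀ᵐ x ∂μ, h (w x) * V x = g x := by
    filter_upwards [hVI, hgI, hVI'] with x h1 h2 h3
    by_cases hx : x ∈ I
    · have := congrFun hh ⟨x, hx⟩
      simp only [Function.comp_apply] at this
      rw [this, div_mul_cancel₀ _ (h1 hx)]
    · rw [h2 hx, h3 hx, mul_zero]
  have hhν : MemLp h p ν := by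
    refine ⟨hhm.aestronglyMeasurable, ?_⟩
    rw [hν, eLpNorm_map_withDensity hp₀ hp hw hVm hhm, eLpNorm_congr_ae hgh]
    exact hg.2
  obtain ⟨φ, hφ, -⟩ := hhν.exists_boundedContinuous_eLpNorm_sub_le hp
    (ENNReal.half_pos hε).ne'
  obtain ⟨δ, hδ, hδε⟩ := ENNReal.exists_nnreal_pos_mul_lt
    (a := ν univ ^ p.toReal⁻¹) (b := ε / 2)
    (ENNReal.rpow_ne_top_of_nonneg (by positivity) (measure_ne_top _ _))
    (ENNReal.half_pos hε).ne'
  obtain ⟨Q, hQ⟩ := exists_polynomial_norm_sub_le φ.continuous (NNReal.coe_pos.2 hδ)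
  refine ⟨Q, ?_⟩
  have hQc : Continuous fun t : ℝ => Q.eval (t : ℂ) := Q.continuous.comp Complex.continuous_ofReal
  have h2 : eLpNorm (fun t : ℝ => φ t - Q.eval (t : ℂ)) p ν ≤ ε / 2 := by
    refine (eLpNorm_le_of_ae_bound (C := (δ : ℝ)) ?_).trans ?_
    · filter_upwards [hν01] with t ht using hQ t ht
    · rw [ENNReal.ofReal_coe_nnreal, mul_comm]
      exact hδε.le
  calc eLpNorm (fun x => g x - Q.eval (w x : ℂ) * V x) p μ
      = eLpNorm (fun x => (h (w x) - Q.eval (w x : ℂ)) * V x) p μ := by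
        refine eLpNorm_congr_ae ?_
        filter_upwards [hgh] with x hx
        rw [sub_mul, hx]
    _ = eLpNorm (fun t : ℝ => h t - Q.eval (t : ℂ)) p ν :=
        (eLpNorm_map_withDensity hp₀ hp hw hVm (hhm.sub hQc.measurable)).symm
    _ = eLpNorm ((h - (φ : ℝ → ℂ)) + fun t : ℝ => φ t - Q.eval (t : ℂ)) p ν := by
        congr 1
        ext t
        simp
    _ ≤ ε / 2 + ε / 2 := (eLpNorm_add_le
        (hhm.aestronglyMeasurable.sub φ.continuous.aestronglyMeasurable)
        (φ.continuous.sub hQc).aestronglyMeasurable hp₁).trans (add_le_add hφ h2)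
    _ = ε := ENNReal.add_halves ε

/-! ### Iterates of the Bishop operators -/

instance : IsFiniteMeasure leb := by unfold leb; infer_instance

instance : NullSingletonClass leb := by unfold leb; infer_instance

theorem ae_mem_Ico : ∀ᵐ x ∂leb, x ∈ Ico (0 : ℝ) 1 := by
  have : leb = volume.restrict (Ico (0 : ℝ) 1) :=
    (Measure.restrict_congr_set Ico_ae_eq_Icc).symm
  rw [this]
  exact ae_restrict_mem measurableSet_Ico

theorem shift_shift (α β x : ℝ) : shift α (shift β x) = shift (β + α) x := by
  unfold shift
  rw [Int.fract_eq_fract]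
  refine ⟨-⌊x + β⌋, ?_⟩
  rw [Int.fract]
  push_cast
  ring

theorem shift_intCast (n : ℤ) {x : ℝ} (hx : x ∈ Ico (0 : ℝ) 1) : shift n x = x := by
  rw [shift, Int.fract_add_intCast, Int.fract_eq_self.2 hx]

theorem shift_mem_Ico (α x : ℝ) : shift α x ∈ Ico (0 : ℝ) 1 :=
  ⟨Int.fract_nonneg _, Int.fract_lt_one _⟩

theorem ae_shift_ne_zero (α : ℝ) : ∀ᵐ x ∂leb, shift α x ≠ 0 := by
  refine (measurePreserving_shift α).quasiMeasurePreserving.ae (p := fun x => x ≠ 0) ?_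
  exact (countable_singleton (0 : ℝ)).ae_notMem _

/-- The weight `{x} {x + α} ⋯ {x + (n - 1) α}` of the `n`-th power of the Bishop operator. -/
noncomputable def weight (α : ℝ) (n : ℕ) (x : ℝ) : ℝ := ∏ i ∈ Finset.range n, shift (i * α) x

theorem measurable_weight (α : ℝ) (n : ℕ) : Measurable (weight α n) :=
  Finset.measurable_fun_prod _ fun i _ => measurable_shift (i * α)

theorem weight_mem_Icc (α : ℝ) (n : ℕ) (x : ℝ) : weight α n x ∈ Icc (0 : ℝ) 1 :=
  ⟨Finset.prod_nonneg fun _ _ => (shift_mem_Ico _ _).1,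
    Finset.prod_le_one (fun _ _ => (shift_mem_Ico _ _).1) fun _ _ => (shift_mem_Ico _ _).2.le⟩

theorem ae_weight_ne_zero (α : ℝ) (n : ℕ) : ∀ᵐ x ∂leb, weight α n x ≠ 0 := by
  have h : ∀ᵐ x ∂leb, ∀ i : ℕ, shift (i * α) x ≠ 0 :=
    ae_all_iff.2 fun i => ae_shift_ne_zero (i * α)
  filter_upwards [h] with x hx
  exact Finset.prod_ne_zero_iff.2 fun i _ => hx i

variable {p : ℝ≥0∞} [Fact (1 ≤ p)]

theorem bishop_ae (α : ℝ) (f : LpUnit p) :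
    ∀ᵐ x ∂leb, bishop p α f x = (x : ℂ) * f (shift α x) :=
  bishop_apply_ae p α f

theorem bishop_pow_ae (α : ℝ) (n : ℕ) (f : LpUnit p) :
    ∀ᵐ x ∂leb, (bishop p α ^ n) f x = (weight α n x : ℂ) * f (shift (n * α) x) := by
  induction n generalizing f with
  | zero =>
    filter_upwards [ae_mem_Ico] with x hx
    have := shift_intCast 0 hx
    simp only [Int.cast_zero] at this
    simp [weight, this]
  | succ n ih =>
    filter_upwards [ih (bishop p α f),
      (measurePreserving_shift (n * α)).quasiMeasurePreserving.ae (bishop_ae α f)] with x h1 h2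
    rw [pow_succ, mul_apply_eq_comp, h1, h2, shift_shift, weight, weight,
      Finset.prod_range_succ]
    push_cast
    rw [add_mul, one_mul]
    ring

theorem norm_bishop_le (α : ℝ) (f : LpUnit p) : ‖bishop p α f‖ ≤ ‖f‖ := by
  refine (ContinuousLinearMap.le_of_opNorm_le _
    (LinearMap.mkContinuous_norm_le _ zero_le_one _) f).trans ?_
  rw [one_mul]

/-! ### Continuity in the rotation angle -/

theorem ae_continuousAt_shift (α : ℝ) :
    ∀ᵐ x ∂leb, ContinuousAt (fun β => shift β x) α := by
  filter_upwards [ae_shift_ne_zero α] with x hx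
  have : ContinuousAt (Int.fract : ℝ → ℝ) (x + α) := by
    refine continuousAt_fract fun h => hx ?_
    rw [shift, Int.fract, ← h, sub_self]
  exact this.comp (f := fun β => x + β) (by fun_prop)

/-- On bounded continuous functions, continuity in the angle is dominated convergence: for almost
every `x`, the map `β ↦ {x + β}` does not jump at `α`. -/
theorem continuous_bishop_apply_boundedContinuous (hp : p ≠ ∞) {f : LpUnit p}
    {φ : BoundedContinuousFunction ℝ ℂ} (hf : f =ᵐ[leb] φ) :
    Continuous fun α => bishop p α f := by
  have hp₀ : p ≠ 0 := (zero_lt_one.trans_le (Fact.out : 1 ≤ p)).ne'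
  have hpt : 0 < p.toReal := ENNReal.toReal_pos hp₀ hp
  refine continuous_iff_continuousAt.2 fun α => ?_
  rw [ContinuousAt, Lp.tendsto_Lp_iff_tendsto_eLpNorm']
  have hform : ∀ β, ∀ᵐ x ∂leb, bishop p β f x = (x : ℂ) * φ (shift β x) := fun β => by
    filter_upwards [bishop_ae β f,
      (measurePreserving_shift β).quasiMeasurePreserving.ae hf] with x h1 h2
    rw [h1, h2]
  have hint : ∀ β, eLpNorm (⇑(bishop p β f) - ⇑(bishop p α f)) p leb =
      (∫⁻ x, ‖(x : ℂ) * φ (shift β x) - x * φ (shift α x)‖ₑ ^ p.toReal ∂leb) ^ (1 / p.toReal) := by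
    intro β
    rw [← eLpNorm_eq_lintegral_rpow_enorm_toReal hp₀ hp]
    refine eLpNorm_congr_ae ?_
    filter_upwards [hform β, hform α] with x h1 h2
    rw [Pi.sub_apply, h1, h2]
  simp only [hint]
  have hz : (0 : ℝ≥0∞) = 0 ^ (1 / p.toReal) := by
    rw [ENNReal.zero_rpow_of_pos (by positivity)]
  rw [hz]
  refine Tendsto.ennrpow_const _ ?_
  have hm : ∀ β, Measurable fun x : ℝ => (x : ℂ) * φ (shift β x) := fun β =>
    Complex.measurable_ofReal.mul (φ.continuous.measurable.comp (measurable_shift β))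
  rw [← lintegral_zero (μ := leb)]
  refine tendsto_lintegral_filter_of_dominated_convergence
    (fun _ => ENNReal.ofReal (‖φ‖ + ‖φ‖) ^ p.toReal)
    (Eventually.of_forall fun β => ((hm β).sub (hm α)).enorm.pow_const _)
    (Eventually.of_forall fun β => ?_) ?_ ?_
  · filter_upwards [ae_mem_Ico] with x hx
    refine ENNReal.rpow_le_rpow ?_ hpt.le
    rw [← ofReal_norm]
    refine ENNReal.ofReal_le_ofReal ?_
    have hb : ∀ y, ‖(x : ℂ) * φ y‖ ≤ ‖φ‖ := fun y => by
      rw [norm_mul, Complex.norm_real, Real.norm_of_nonneg hx.1]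
      exact (mul_le_of_le_one_left (norm_nonneg _) hx.2.le).trans (φ.norm_coe_le_norm y)
    exact (norm_sub_le _ _).trans (add_le_add (hb _) (hb _))
  · rw [lintegral_const]
    exact ENNReal.mul_ne_top (ENNReal.rpow_ne_top_of_nonneg hpt.le ENNReal.ofReal_ne_top)
      (measure_ne_top _ _)
  · filter_upwards [ae_continuousAt_shift α] with x hx
    have h1 : Tendsto (fun β => (x : ℂ) * φ (shift β x) - x * φ (shift α x)) (𝓝 α) (𝓝 0) := by
      have : ContinuousAt (fun β => (x : ℂ) * φ (shift β x) - x * φ (shift α x)) α :=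
        (continuousAt_const.mul (φ.continuous.continuousAt.comp hx)).sub continuousAt_const
      simpa [ContinuousAt] using this
    have h2 := (h1.enorm).ennrpow_const p.toReal
    simpa [ENNReal.zero_rpow_of_pos hpt] using h2

theorem continuous_bishop_apply (hp : p ≠ ∞) (f : LpUnit p) :
    Continuous fun α => bishop p α f := by
  -- The contractions `T_α` are equicontinuous, so a uniform approximation argument applies.
  refine continuous_of_uniform_approx_of_continuous fun u hu => ?_
  obtain ⟨ε, hε, hu⟩ := Metric.mem_uniformity_dist.1 hu
  obtain ⟨φ, hφ, hφm⟩ := (Lp.memLp f).exists_boundedContinuous_eLpNorm_sub_le hp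
    (ε := ENNReal.ofReal (ε / 2)) (ENNReal.ofReal_pos.2 (half_pos hε)).ne'
  refine ⟨fun α => bishop p α (hφm.toLp φ),
    continuous_bishop_apply_boundedContinuous hp hφm.coeFn_toLp, fun α => hu ?_⟩
  have h : ‖f - hφm.toLp φ‖ ≤ ε / 2 := by
    rw [Lp.norm_def]
    refine ENNReal.toReal_le_of_le_ofReal (half_pos hε).le ((eLpNorm_congr_ae ?_).trans_le hφ)
    filter_upwards [Lp.coeFn_sub f (hφm.toLp φ), hφm.coeFn_toLp] with x h1 h2
    rw [h1, Pi.sub_apply, Pi.sub_apply, h2]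
  rw [dist_eq_norm, ← map_sub]
  exact ((norm_bishop_le α _).trans h).trans_lt (half_lt_self hε)

theorem continuous_bishop_pow_apply (hp : p ≠ ∞) (n : ℕ) (f : LpUnit p) :
    Continuous fun α => (bishop p α ^ n) f := by
  induction n with
  | zero => simpa using continuous_const
  | succ n ih =>
    refine continuous_iff_continuousAt.2 fun α => tendsto_iff_norm_sub_tendsto_zero.2 ?_
    have h1 := tendsto_iff_norm_sub_tendsto_zero.1 (ih.tendsto α)
    have h2 := tendsto_iff_norm_sub_tendsto_zero.1
      ((continuous_bishop_apply hp ((bishop p α ^ n) f)).tendsto α)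
    refine squeeze_zero (fun _ => norm_nonneg _) (fun β => ?_) 
      (by simpa only [add_zero] using h1.add h2)
    calc ‖(bishop p β ^ (n + 1)) f - (bishop p α ^ (n + 1)) f‖
        = ‖bishop p β ((bishop p β ^ n) f - (bishop p α ^ n) f) +
            (bishop p β ((bishop p α ^ n) f) - bishop p α ((bishop p α ^ n) f))‖ := by
          rw [pow_succ', pow_succ', mul_apply_eq_comp, mul_apply_eq_comp, map_sub,
            sub_add_sub_cancel]
      _ ≤ _ := (norm_add_le _ _).trans (add_le_add_left (norm_bishop_le _ _) _)

/-! ### The weight of a rational rotation -/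

section Rational

variable {α : ℝ} {q : ℕ} {r : ℤ}

theorem floor_add_mul_of_rational (hq : 0 < q) (hα : q * α = r) (i : ℕ) (x : ℝ) :
    ⌊x + i * α⌋ = (⌊q * x⌋ + i * r) / (q : ℤ) := by
  have hq' : (q : ℝ) ≠ 0 := by positivity
  have h : x + i * α = (q * x + (i * r : ℤ)) / q := by
    push_cast
    rw [← hα]
    field_simp
  rw [h, Int.floor_div_natCast, Int.floor_add_intCast]

theorem shift_lt_shift (hq : 0 < q) (hα : q * α = r) (i : ℕ) {x y : ℝ}
    (hc : ⌊q * x⌋ = ⌊q * y⌋) (hxy : x < y) : shift (i * α) x < shift (i * α) y := by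
  rw [shift, shift, Int.fract, Int.fract, floor_add_mul_of_rational hq hα,
    floor_add_mul_of_rational hq hα, hc]
  linarith

/-- On each cell `[k / q, (k + 1) / q)` every factor of the weight is strictly increasing. -/
theorem weight_lt_weight (hq : 0 < q) (hα : q * α = r) {x y : ℝ}
    (hc : ⌊q * x⌋ = ⌊q * y⌋) (hxy : x < y) : weight α q x < weight α q y := by
  have hlt : ∀ i : ℕ, shift (i * α) x < shift (i * α) y := fun i =>
    shift_lt_shift hq hα i hc hxy
  have hpos : 0 < weight α q y :=
    Finset.prod_pos fun i _ => (shift_mem_Ico _ _).1.trans_lt (hlt i)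
  by_cases h0 : weight α q x = 0
  · rwa [h0]
  · refine Finset.prod_lt_prod_of_nonempty (fun i hi => ?_) (fun i _ => hlt i)
      (Finset.nonempty_range_iff.2 hq.ne')
    exact (shift_mem_Ico _ _).1.lt_of_ne' (Finset.prod_ne_zero_iff.1 h0 i hi)

theorem eq_of_weight_eq (hq : 0 < q) (hα : q * α = r) {x y : ℝ}
    (hc : ⌊q * x⌋ = ⌊q * y⌋) (hw : weight α q x = weight α q y) : x = y := by
  rcases lt_trichotomy x y with h | h | h
  · exact absurd hw (weight_lt_weight hq hα hc h).ne
  · exact h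
  · exact absurd hw (weight_lt_weight hq hα hc.symm h).ne'

theorem ae_eval_weight_ne_zero (hq : 0 < q) (hα : q * α = r) {R : ℂ[X]} (hR : R ≠ 0) :
    ∀ᵐ x ∂leb, R.eval (weight α q x : ℂ) ≠ 0 := by
  have hc : {x : ℝ | R.eval (weight α q x : ℂ) = 0}.Countable := by
    refine MapsTo.countable_of_injOn (t := (R.rootSet ℂ) ×ˢ (univ : Set ℤ))
      (f := fun x : ℝ => ((weight α q x : ℂ), ⌊q * x⌋)) (fun x hx => ⟨?_, mem_univ _⟩)
      (fun x _ y _ hxy => ?_) ((R.rootSet_finite ℂ).countable.prod countable_univ)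
    · rw [mem_rootSet]
      exact ⟨hR, by simpa using hx⟩
    · simp only [Prod.mk.injEq, Complex.ofReal_inj] at hxy
      exact eq_of_weight_eq hq hα hxy.2 hxy.1
  exact hc.ae_notMem _

/-- The set of points of `[0, 1)` sent to `[0, 1 / q)` by the `j`-th iterate of the rotation. -/
def arc (α : ℝ) (q j : ℕ) : Set ℝ := Ico 0 1 ∩ shift (j * α) ⁻¹' {x | q * x < 1}

theorem measurableSet_arc (α : ℝ) (q j : ℕ) : MeasurableSet (arc α q j) :=
  measurableSet_Ico.inter (measurable_shift _
    (measurableSet_lt (measurable_id.const_mul _) measurable_const))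

theorem floor_eq_of_mem_arc (hq : 0 < q) (hα : q * α = r) {j : ℕ} {x y : ℝ}
    (hx : x ∈ arc α q j) (hy : y ∈ arc α q j) : ⌊q * x⌋ = ⌊q * y⌋ := by
  have hq' : (0 : ℝ) < q := by positivity
  -- Inside the arc, `⌊q x⌋` is determined modulo `q`.
  have key : ∀ z ∈ arc α q j, ⌊q * z⌋ = q * ⌊z + j * α⌋ - j * r ∧ 0 ≤ ⌊q * z⌋ ∧ ⌊q * z⌋ < q := by
    rintro z ⟨hz, hz'⟩
    refine ⟨?_, Int.floor_nonneg.2 (mul_nonneg hq'.le hz.1), ?_⟩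
    · rw [Int.floor_eq_iff]
      have h0 := mul_nonneg hq'.le (shift_mem_Ico (j * α) z).1
      simp only [mem_preimage, mem_ofPred_eq] at hz'
      have e : (q : ℝ) * shift (j * α) z = q * z + j * r - q * ⌊z + j * α⌋ := by
        rw [shift, Int.fract, ← hα]
        ring
      rw [e] at hz' h0
      push_cast
      constructor <;> linarith
    · rw [Int.floor_lt]
      have := mul_lt_mul_of_pos_left hz.2 hq'
      simpa using this
  obtain ⟨hx1, hx2, hx3⟩ := key x hx
  obtain ⟨hy1, hy2, hy3⟩ := key y hy
  rw [← Int.emod_eq_of_lt hx2 hx3, ← Int.emod_eq_of_lt hy2 hy3, hx1, hy1]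
  refine Int.ModEq.sub_right _ ?_
  rw [Int.ModEq, Int.mul_emod_right, Int.mul_emod_right]

theorem injOn_weight_arc (hq : 0 < q) (hα : q * α = r) (j : ℕ) :
    InjOn (weight α q) (arc α q j) := fun _ hx _ hy h =>
  eq_of_weight_eq hq hα (floor_eq_of_mem_arc hq hα hx hy) h

theorem exists_mem_arc (hq : 0 < q) (hα : q * α = r) (hr : IsCoprime r q) {x : ℝ}
    (hx : x ∈ Ico (0 : ℝ) 1) : ∃ j < q, x ∈ arc α q j := by
  have hq' : (0 : ℝ) < q := by positivity
  have hqz : (0 : ℤ) < q := by positivity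
  obtain ⟨a, b, hab⟩ := hr
  -- `j` is a solution of `⌊q x⌋ + j r ≡ 0` modulo `q`.
  set k := ⌊q * x⌋ with hk
  set j := (-k * a) % (q : ℤ) with hj
  have hj0 : 0 ≤ j := Int.emod_nonneg _ hqz.ne'
  have hjq : j < q := Int.emod_lt_of_pos _ hqz
  have hdvd : (q : ℤ) ∣ k + j * r := by
    have h1 : (q : ℤ) ∣ (-k * a) - j := Int.dvd_self_sub_emod
    have h2 : k + j * r = q * (b * k) - ((-k * a) - j) * r := by linear_combination -k * hab
    rw [h2]
    exact (dvd_mul_right _ _).sub (h1.mul_right _)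
  lift j to ℕ using hj0 with j' hj'
  refine ⟨j', by exact_mod_cast hjq, hx, ?_⟩
  obtain ⟨n, hn⟩ := hdvd
  have hfl : ⌊x + j' * α⌋ = n := by
    rw [floor_add_mul_of_rational hq hα, ← hk, hn, Int.mul_ediv_cancel_left _ hqz.ne']
  have hn' : (k : ℝ) + j' * r = q * n := by exact_mod_cast hn
  have e : (q : ℝ) * shift (j' * α) x = q * x - k := by
    rw [shift, Int.fract, hfl]
    linear_combination hn' + (j' : ℝ) * hα
  rw [mem_preimage, mem_ofPred_eq, e]
  exact sub_lt_iff_lt_add'.2 (Int.lt_floor_add_one _)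

end Rational

/-! ### Cyclic vectors of rational Bishop operators -/

section Operators

variable {p : ℝ≥0∞} [Fact (1 ≤ p)] {α : ℝ} {q : ℕ} {r : ℤ}

/-- For a rotation of order `q`, the `q`-th power of the Bishop operator is the multiplication by
its weight, hence so are the polynomials in it. -/
theorem aeval_bishop_pow_ae (hα : q * α = r) (R : ℂ[X]) (f : LpUnit p) :
    ∀ᵐ x ∂leb, aeval (bishop p α ^ q) R f x = R.eval (weight α q x : ℂ) * f x := by
  have h1 : ∀ g : LpUnit p, ∀ᵐ x ∂leb, (bishop p α ^ q) g x = (weight α q x : ℂ) * g x := by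
    intro g
    filter_upwards [bishop_pow_ae α q g, ae_mem_Ico] with x hx h01
    rw [hx, hα, shift_intCast r h01]
  have h2 : ∀ n : ℕ, ∀ᵐ x ∂leb,
      ((bishop p α ^ q) ^ n) f x = (weight α q x : ℂ) ^ n * f x := by
    intro n
    induction n with
    | zero => simp
    | succ n ih =>
      filter_upwards [ih, h1 (((bishop p α ^ q) ^ n) f)] with x hx hx'
      rw [_root_.pow_succ', mul_apply_eq_comp, hx', hx]
      ring
  induction R using Polynomial.induction_on' with
  | add P Q hP hQ =>
    filter_upwards [hP, hQ, Lp.coeFn_add (aeval (bishop p α ^ q) P f)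
      (aeval (bishop p α ^ q) Q f)] with x hp hq h
    rw [map_add, _root_.add_apply, h, Pi.add_apply, hp, hq, eval_add, add_mul]
  | monomial n a =>
    filter_upwards [h2 n, Lp.coeFn_smul a (((bishop p α ^ q) ^ n) f)] with x hx h
    rw [aeval_monomial, ← Algebra.smul_def, _root_.smul_apply, h, Pi.smul_apply, hx,
      eval_monomial, smul_eq_mul, mul_assoc]

/-- The indicator function of `[0, 1 / q)`. -/
noncomputable def baseVector (p : ℝ≥0∞) (q : ℕ) : LpUnit p :=
  indicatorConstLp p (measurableSet_lt (measurable_id.const_mul (q : ℝ)) measurable_const)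
    (measure_ne_top leb {x : ℝ | q * x < 1}) 1

theorem bishop_pow_baseVector_ae (α : ℝ) (q j : ℕ) :
    ∀ᵐ x ∂leb, (bishop p α ^ j) (baseVector p q) x =
      (arc α q j).indicator (fun x => (weight α j x : ℂ)) x := by
  filter_upwards [bishop_pow_ae α j (baseVector p q), ae_mem_Ico,
    (measurePreserving_shift (j * α)).quasiMeasurePreserving.ae
      (indicatorConstLp_coeFn (p := p) (μ := leb) (c := (1 : ℂ))
        (hs := measurableSet_lt (measurable_id.const_mul (q : ℝ)) measurable_const)
        (hμs := measure_ne_top leb {x : ℝ | q * x < 1}))] with x h1 h01 h2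
  rw [h1, baseVector]
  simp only [id_eq] at h2
  rw [h2]
  by_cases hx : x ∈ arc α q j
  · rw [indicator_of_mem hx,
      indicator_of_mem (a := shift (j * α) x) (s := {a | (q : ℝ) * a < 1}) hx.2, mul_one]
  · rw [indicator_of_notMem hx,
      indicator_of_notMem (a := shift (j * α) x) (s := {a | (q : ℝ) * a < 1})
        fun h => hx ⟨h01, h⟩, mul_zero]

/-- On the arc `I_j`, the vectors `Q(T ^ q) R(T ^ q) T ^ j e = Q(w) R(w) T ^ j e`, with `Q` a
polynomial and `e` the indicator function of `[0, 1 / q)`, are dense; the arcs cover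
`[0, 1)`. -/
theorem denseRange_aeval_baseVector (hp : p ≠ ∞) (hq : 0 < q) (hα : q * α = r)
    (hr : IsCoprime r q) {R : ℂ[X]} (hR : R ≠ 0) :
    DenseRange fun P : ℂ[X] =>
      aeval (bishop p α) (R.comp (Polynomial.X ^ q) * P) (baseVector p q) := by
  set T := bishop p α with hT
  set e := baseVector p q
  let L : ℂ[X] →ₗ[ℂ] LpUnit p :=
    (ContinuousLinearMap.apply ℂ (LpUnit p) e).toLinearMap ∘ₗ (aeval (R := ℂ) T).toLinearMap ∘ₗ
      LinearMap.mulLeft ℂ (R.comp (Polynomial.X ^ q))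
  let N := (LinearMap.range L).topologicalClosure
  have hN : ∀ (j : ℕ) (g : LpUnit p), (∀ᵐ x ∂leb, x ∉ arc α q j → g x = 0) →
      g ∈ N := by
    intro j g hg
    refine Metric.mem_closure_iff.2 fun ε hε => ?_
    set V := aeval (T ^ q) R ((T ^ j) e) with hV
    have hVae : ∀ᵐ x ∂leb, V x = R.eval (weight α q x : ℂ) *
        (arc α q j).indicator (fun x => (weight α j x : ℂ)) x := by
      filter_upwards [aeval_bishop_pow_ae hα R ((T ^ j) e), bishop_pow_baseVector_ae (p := p) α q j]
        with x h1 h2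
      rw [h1, h2]
    obtain ⟨Q, hQ⟩ := exists_polynomial_eLpNorm_sub_le (Fact.out : 1 ≤ p) hp
      (measurableSet_arc α q j) (measurable_weight α q) (weight_mem_Icc α q)
      (injOn_weight_arc hq hα j) (Lp.stronglyMeasurable V).measurable (Lp.memLp V)
      (Lp.stronglyMeasurable g).measurable (Lp.memLp g)
      (by
        filter_upwards [hVae, ae_eval_weight_ne_zero hq hα hR, ae_weight_ne_zero α j]
          with x h1 h2 h3 hx
        rw [h1, indicator_of_mem hx]
        exact mul_ne_zero h2 (Complex.ofReal_ne_zero.2 h3))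
      hg
      (by
        filter_upwards [hVae] with x h1 hx
        rw [h1, indicator_of_notMem hx, mul_zero])
      (ENNReal.ofReal_pos.2 (half_pos hε)).ne'
    refine ⟨_, ⟨Q.comp (Polynomial.X ^ q) * Polynomial.X ^ j, rfl⟩, ?_⟩
    have hL : L (Q.comp (Polynomial.X ^ q) * Polynomial.X ^ j) = aeval (T ^ q) Q V := by
      have hc : R.comp (Polynomial.X ^ q) * (Q.comp (Polynomial.X ^ q) * Polynomial.X ^ j) =
          Q.comp (Polynomial.X ^ q) * (R.comp (Polynomial.X ^ q) * Polynomial.X ^ j) := by ring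
      change aeval T (R.comp (Polynomial.X ^ q) *
        (Q.comp (Polynomial.X ^ q) * Polynomial.X ^ j)) e = _
      rw [hc, map_mul, map_mul, mul_apply_eq_comp, mul_apply_eq_comp, aeval_comp, aeval_comp,
        map_pow, aeval_X, map_pow, aeval_X]
    rw [hL, dist_eq_norm, Lp.norm_def]
    refine lt_of_le_of_lt (ENNReal.toReal_le_of_le_ofReal (half_pos hε).le
      ((eLpNorm_congr_ae ?_).trans_le hQ)) (half_lt_self hε)
    filter_upwards [Lp.coeFn_sub g (aeval (T ^ q) Q V), aeval_bishop_pow_ae hα Q V] with x h1 h2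
    rw [h1, Pi.sub_apply, h2]
  -- Peel off the arcs one at a time.
  have hU : ∀ (n : ℕ) (g : LpUnit p), (∀ᵐ x ∂leb, (∀ j < n, x ∉ arc α q j) → g x = 0) →
      g ∈ N := by
    intro n
    induction n with
    | zero =>
      intro g hg
      have : g = 0 := by
        rw [Lp.eq_zero_iff_ae_eq_zero]
        filter_upwards [hg] with x hx
        exact hx (by simp)
      rw [this]
      exact N.zero_mem
    | succ n ih =>
      intro g hg
      have hm := measurableSet_arc α q n
      have m1 : MemLp ((arc α q n).indicator g) p leb := (Lp.memLp g).indicator hm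
      have h1 : m1.toLp ∈ N := by
        refine hN n _ ?_
        filter_upwards [m1.coeFn_toLp] with x hx hxn
        rw [hx, indicator_of_notMem hxn]
      have h2 : g - m1.toLp ∈ N := by
        refine ih _ ?_
        filter_upwards [Lp.coeFn_sub g m1.toLp, m1.coeFn_toLp, hg] with x hx1 hx2 hx3 hx
        rw [hx1, Pi.sub_apply, hx2]
        by_cases hxn : x ∈ arc α q n
        · rw [indicator_of_mem hxn, sub_self]
        · rw [indicator_of_notMem hxn, sub_zero]
          refine hx3 fun j hj => ?_
          rcases Nat.lt_succ_iff_lt_or_eq.1 hj with h | rfl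
          · exact hx j h
          · exact hxn
      simpa using N.add_mem h1 h2
  intro g
  have : g ∈ N := by
    refine hU q g ?_
    filter_upwards [ae_mem_Ico] with x hx h
    obtain ⟨j, hj, hxj⟩ := exists_mem_arc hq hα hr hx
    exact absurd hxj (h j hj)
  exact this

theorem dense_isCyclicVector_bishop_ratCast (hp : p ≠ ∞) (s : ℚ) :
    Dense {f : LpUnit p | IsCyclicVector (bishop p (s : ℝ)) f} := by
  refine dense_isCyclicVector (q := s.den) (e := baseVector p s.den) fun R hR =>
    denseRange_aeval_baseVector hp s.den_pos (r := s.num) ?_ ?_ hR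
  · exact_mod_cast Rat.den_mul_eq_num s
  · exact Int.isCoprime_iff_gcd_eq_one.2 s.reduced

end Operators

theorem dense_ratCast_unitInterval : Dense {α : Icc (0 : ℝ) 1 | ∃ s : ℚ, (s : ℝ) = α} := by
  refine Metric.dense_iff.2 fun x ε hε => ?_
  obtain ⟨s, hs1, hs2⟩ := exists_rat_btwn (x := max 0 (x.1 - ε)) (y := min 1 (x.1 + ε)) (by
    have h0 := x.2.1
    have h1 := x.2.2
    rw [max_lt_iff, lt_min_iff, lt_min_iff]
    refine ⟨⟨?_, ?_⟩, ?_, ?_⟩ <;> linarith)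
  rw [max_lt_iff] at hs1
  rw [lt_min_iff] at hs2
  refine ⟨⟨s, hs1.1.le, hs2.1.le⟩, ?_, s, rfl⟩
  rw [Metric.mem_ball, Subtype.dist_eq, Real.dist_eq, abs_lt]
  constructor <;> linarith [hs1.2, hs2.2]

end Bishop

/-- For `1 < p < ∞`, the set of `α ∈ [0, 1]` such that the Bishop operator `T_α` is cyclic on
`L ^ p([0, 1])` is co-meager: it contains a dense `G_δ` subset of `[0, 1]`. -/
theorem theorem4 (p : ℝ≥0∞) [Fact (1 ≤ p)] (hp₁ : 1 < p) (hp₂ : p ≠ ∞) :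
    ∃ G : Set (Icc (0 : ℝ) 1),
      IsGδ G ∧ Dense G ∧ G ⊆ {α : Icc (0 : ℝ) 1 | Bishop.IsCyclic (Bishop.bishop p (α : ℝ))} := by
  have : Fact (p ≠ ∞) := ⟨hp₂⟩
  refine Bishop.exists_isGδ_dense_isCyclic (fun α : Icc (0 : ℝ) 1 => Bishop.bishop p (α : ℝ))
    (fun n f => (Bishop.continuous_bishop_pow_apply hp₂ n f).comp continuous_subtype_val) ?_
  refine Bishop.dense_ratCast_unitInterval.mono ?_
  rintro α ⟨s, hs⟩
  rw [mem_ofPred_eq, ← hs]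
  exact Bishop.dense_isCyclicVector_bishop_ratCast hp₂ s
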